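/- Let $k$ be an algebraically closed field, let $A$ be a finite-dimensional associative unital $k$-algebra, and let $(\Lambda,\leqslant)$ be a finite poset. All $A$-modules are finitely generated left modules. Let $(\underline\Theta,\underline Q)=(\{\Theta_\lambda\}_{\lambda\in\Lambda},\{Q_\lambda\}_{\lambda\in\Lambda})$ be an Ext-projective stratifying system. That is, the $\Theta_\lambda$ are nonzero $A$-modules and the $Q_\lambda$ are indecomposable $A$-modules such that 1. $\mathrm{Hom}_A(\Theta_\lambda,\Theta_\mu)=0$ whenever $\lambda\nleqslant\mu$; 2. for each $\lambda$ there is an exact sequence $0\to K_\lambda\to Q_\lambda\to\Theta_\lambda\to 0$ in which $K_\lambda$ has a finite filtration whose factors are isomorphic to modules $\Theta_\mu$ with $\mu>\lambda$; 3. $\mathrm{Ext}^1_A(Q_\lambda,M)=0$ for every $\lambda$ and every $A$-module $M$ that has a finite filtration whose factors are isomorphic to modules $\Theta_\mu$, $\mu\in\Lambda$. Put $\Theta=\bigoplus_{\lambda}\Theta_\lambda$ and $Q=\bigoplus_\lambda Q_\lambda$, and suppose that $\mathrm{Ext}^s_A(Q,\Theta)=0$ for all $s\geqslant 1$ and $\mathrm{End}_A(\Theta_\lambda)\cong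 k$ for all $\lambda\in\Lambda$. Let $\Gamma=\mathrm{Ext}^*_A(\Theta,\Theta)=\bigoplus_{s\geqslant 0}\mathrm{Ext}^s_A(\Theta,\Theta)$ with the Yoneda product, composed from right to left, and let $e_\lambda\in\Gamma$ be the degree-zero idempotent given by the projection of $\Theta$ onto $\Theta_\lambda$. Then $\Gamma$ is quasi-hereditary with respect to both $(\Lambda,\leqslant)$ and $(\Lambda,\leqslant^{op})$, where $\lambda\in\Lambda$ labels the projective left $\Gamma$-module $P_\lambda=\Gamma e_\lambda\cong\mathrm{Ext}^*_A(\Theta_\lambda,\Theta)$ and its top $S_\lambda=P_\lambda/\mathrm{rad}\,P_\lambda$. Here a $k$-algebra $B$, with projective left modules $P_\lambda$ labelled by a poset $(\Lambda,\preccurlyeq)$, is called quasi-hereditary with respect to $\preccurlyeq$ if $B$ is finite-dimensional, the $P_\lambda$ are finitely generated with simple tops $S_\lambda$, the $S_\lambda$ form a complete list of the simple $B$-modules up to isomorphism without repetition, and there are $B$-modules $\Delta_\lambda$ ($\lambda\in\Lambda$) such that for all $\lambda$: - the multiplicity $[\Delta_\lambda:S_\mu]$ is $0$ whenever $\mu\not\preccurlyeq\lambda$;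 - there is an exact sequence $0\to K_\lambda\to P_\lambda\to\Delta_\lambda\to0$ in which $K_\lambda$ has a finite filtration whose factors are isomorphic to modules $\Delta_\mu$ with $\mu\succ\lambda$; - $\mathrm{End}_B(\Delta_\lambda)\cong k$. -/

import Mathlib

open CategoryTheory CategoryTheory.Limits CategoryTheory.Abelian

universe w v v' u u'

attribute [local instance] Abelian.hasFiniteBiproducts

noncomputable section

/-! ### The Yoneda algebra of an object of a linear abelian category -/

section YonedaAlgebra

variable {C : Type u} [Category.{v} C] [Abelian C] [HasExt.{w} C]

theorem gradedExt_comp_eq {X : C} {a b c c' : ℕ} (x : Ext X X a) (y : Ext X X b)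
    (h : a + b = c) (h' : a + b = c') :
    (GradedMonoid.mk c (x.comp y h) : GradedMonoid fun i => Ext X X i) =
      GradedMonoid.mk c' (x.comp y h') := by
  subst h
  subst h'
  rfl

/-- The Yoneda product. Morphisms are composed from right to left: the product `x * y` is "first
`y`, then `x`". -/
instance extGMul (X : C) : GradedMonoid.GMul (fun i : ℕ => Ext X X i) where
  mul {i j} x y := y.comp x (Nat.add_comm j i)

instance extGOne (X : C) : GradedMonoid.GOne (fun i : ℕ => Ext X X i) where
  one := Ext.mk₀ (𝟙 X)

instance extGMonoid (X : C) : GradedMonoid.GMonoid (fun i : ℕ => Ext X X i) where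
  one_mul := by
    rintro ⟨i, x⟩
    exact (gradedExt_comp_eq x (Ext.mk₀ (𝟙 X)) (Nat.add_comm i 0) (Nat.add_zero i)).trans
      (congrArg (GradedMonoid.mk i) (Ext.comp_mk₀_id x))
  mul_one := by
    rintro ⟨i, x⟩
    exact (gradedExt_comp_eq (Ext.mk₀ (𝟙 X)) x (Nat.add_comm 0 i) (Nat.zero_add i)).trans
      (congrArg (GradedMonoid.mk i) (Ext.mk₀_id_comp x))
  mul_assoc := by
    rintro ⟨i, x⟩ ⟨j, y⟩ ⟨l, z⟩
    refine (gradedExt_comp_eq z (y.comp x (Nat.add_comm j i)) _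
      (show l + (i + j) = i + (j + l) by omega)).trans ?_
    exact congrArg (GradedMonoid.mk (i + (j + l)))
      (Ext.comp_assoc z y x (Nat.add_comm l j) (Nat.add_comm j i)
        (show l + j + i = i + (j + l) by omega)).symm

/-- The graded ring structure on the groups `Ext X X i`, given by the Yoneda product. -/
instance extGRing (X : C) : DirectSum.GRing (fun i : ℕ => Ext X X i) where
  __ := extGMonoid X
  mul_zero x := Ext.zero_comp _ _ x _ _
  zero_mul x := Ext.comp_zero x _ _ _ _
  mul_add x y z := Ext.add_comp y z x _
  add_mul x y z := Ext.comp_add z x y _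
  natCast n := n • Ext.mk₀ (𝟙 X)
  natCast_zero := zero_nsmul _
  natCast_succ n := succ_nsmul _ n
  intCast n := n • Ext.mk₀ (𝟙 X)
  intCast_ofNat n := natCast_zsmul _ n
  intCast_negSucc_ofNat n := negSucc_zsmul _ n

/-- The extension algebra `Ext^*(X, X)`, the direct sum of all `Ext^i(X, X)` for `i ≥ 0`. -/
def ExtAlgebra (X : C) : Type w := DirectSum ℕ (fun i : ℕ => Ext X X i)

instance (X : C) : Ring (ExtAlgebra X) :=
  inferInstanceAs (Ring (DirectSum ℕ (fun i : ℕ => Ext X X i)))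

/-- The inclusion of the component of degree `i` into `Ext^*(X, X)`. -/
def ExtAlgebra.of (X : C) (i : ℕ) : Ext X X i →+ ExtAlgebra X :=
  DirectSum.of (fun i : ℕ => Ext X X i) i

variable (k : Type v') [CommRing k] [Linear k C]

/-- The scalars act on `Ext^*(X, X)` through `k → End X = Ext^0(X, X)`. -/
instance extGAlgebra (X : C) : DirectSum.GAlgebra k (fun i : ℕ => Ext X X i) where
  toFun :=
    { toFun := fun r => Ext.mk₀ (r • 𝟙 X)
      map_zero' := by rw [zero_smul, Ext.mk₀_zero]
      map_add' := fun r s => by rw [add_smul, Ext.mk₀_add] }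
  map_one := congrArg Ext.mk₀ (one_smul k (𝟙 X))
  map_mul r s := by
    refine congrArg (GradedMonoid.mk 0) ?_
    refine Eq.trans ?_ (Ext.mk₀_comp_mk₀ (s • 𝟙 X) (r • 𝟙 X)).symm
    refine congrArg Ext.mk₀ ?_
    rw [Linear.smul_comp, Linear.comp_smul, Category.comp_id, smul_smul, mul_comm]
  commutes := by
    rintro r ⟨i, x⟩
    refine (gradedExt_comp_eq x (Ext.mk₀ (r • 𝟙 X)) (Nat.add_comm i 0) (Nat.add_zero i)).trans ?_
    refine Eq.trans ?_
      (gradedExt_comp_eq (Ext.mk₀ (r • 𝟙 X)) x (Nat.add_comm 0 i) (Nat.zero_add i)).symm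
    refine congrArg (GradedMonoid.mk i) ?_
    rw [Ext.mk₀_smul, Ext.comp_smul, Ext.smul_comp, Ext.comp_mk₀_id, Ext.mk₀_id_comp]
  smul_def := by
    rintro r ⟨i, x⟩
    refine Eq.trans ?_
      (gradedExt_comp_eq x (Ext.mk₀ (r • 𝟙 X)) (Nat.add_comm i 0) (Nat.add_zero i)).symm
    exact congrArg (GradedMonoid.mk i) (Ext.smul_eq_comp_mk₀ x r)

instance (X : C) : Algebra k (ExtAlgebra X) :=
  inferInstanceAs (Algebra k (DirectSum ℕ (fun i : ℕ => Ext X X i)))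

/-- For a finite direct sum `X = ⨁ Xₗ`, the idempotent of degree zero of `Ext^*(X, X)` given by
the projection of `X` onto its summand `Xₗ`. -/
def ExtAlgebra.idem {Λ : Type u'} [Finite Λ] (X : Λ → C) (l : Λ) : ExtAlgebra (⨁ X) :=
  ExtAlgebra.of (⨁ X) 0 (Ext.mk₀ (biproduct.π X l ≫ biproduct.ι X l))

/-- The projective left `Ext^*(X, X)`-module `Ext^*(X, X) eₗ`, which is `Ext^*(Xₗ, X)`. -/
def ExtAlgebra.proj {Λ : Type u'} [Finite Λ] (X : Λ → C) (l : Λ) :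
    ModuleCat.{w} (ExtAlgebra (⨁ X)) :=
  ModuleCat.of (ExtAlgebra (⨁ X))
    (Submodule.span (ExtAlgebra (⨁ X)) {ExtAlgebra.idem X l})

end YonedaAlgebra

/-! ### Filtrations and composition factors -/

section Modules

variable {B : Type u} [Ring B]

/-- `M` has a finite filtration `0 = N₀ ⊆ N₁ ⊆ ⋯ ⊆ Nₙ = M` each of whose factors is isomorphic
to `F l` for some index `l` in `s`. -/
def IsFiltered {Λ : Type u'} (F : Λ → ModuleCat.{u} B) (s : Set Λ) (M : ModuleCat.{u} B) : Prop :=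
  ∃ (n : ℕ) (N : Fin (n + 1) → Submodule B M), Monotone N ∧ N 0 = ⊥ ∧ N (Fin.last n) = ⊤ ∧
    ∀ i : Fin n, ∃ l ∈ s,
      Nonempty ((N i.succ ⧸ (N i.castSucc).submoduleOf (N i.succ)) ≃ₗ[B] F l)

/-- The simple module `S` is a composition factor of the (finite length) module `M`, that is, the
multiplicity `[M : S]` is not zero: `S` is isomorphic to a subquotient of `M`. -/
def IsCompositionFactor (S M : ModuleCat.{u} B) : Prop :=
  ∃ N₁ N₂ : Submodule B M, N₁ ≤ N₂ ∧ Nonempty ((N₂ ⧸ N₁.submoduleOf N₂) ≃ₗ[B] S)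

/-- The top `M / rad M` of a module. -/
def moduleTop (M : ModuleCat.{u} B) : ModuleCat.{u} B :=
  ModuleCat.of B (M ⧸ Module.jacobson B M)

/-- `P` lists the indecomposable projective modules of a finite-dimensional algebra, and their
tops list the simple modules, up to isomorphism and without repetition: `P l` is the projective
cover of the simple module `moduleTop (P l)`. -/
structure IsProjectiveLabelling {Λ : Type u'} (P : Λ → ModuleCat.{u} B) : Prop where
  finite : ∀ l, Module.Finite B (P l)
  projective : ∀ l, Module.Projective B (P l)
  simple_top : ∀ l, IsSimpleModule B (moduleTop (P l))
  injective : ∀ l m, Nonempty (moduleTop (P l) ≃ₗ[B] moduleTop (P m)) → l = m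
  exhaustive : ∀ S : ModuleCat.{u} B, IsSimpleModule B S →
    ∃ l, Nonempty (S ≃ₗ[B] moduleTop (P l))

/-- `Δ` is a family of standard modules for the indecomposable projective modules `P l`, with
simple tops `Sₗ`, labelled by a poset: `[Δ l : Sₘ] = 0` unless `m ≤ l`, and there are exact
sequences `0 → K l → P l → Δ l → 0` such that `K l` has a filtration with factors `Δ m` with
`l < m`. -/
structure IsStandardFamily {Λ : Type u'} [PartialOrder Λ] (P Δ : Λ → ModuleCat.{u} B) : Prop where
  compositionFactor_le : ∀ l m, IsCompositionFactor (moduleTop (P m)) (Δ l) → m ≤ l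
  exact_sequence : ∀ l, ∃ p : P l →ₗ[B] Δ l, Function.Surjective p ∧
    IsFiltered Δ {m | l < m} (ModuleCat.of B (LinearMap.ker p))

end Modules

/-! ### Quasi-hereditary algebras and Ext-projective stratifying systems -/

section Algebras

variable (k : Type v) [Field k] (B : Type u) [Ring B] [Algebra k B]

/-- The algebra `B` is quasi-hereditary with respect to the order of `Λ`, which labels the
indecomposable projective modules `P l` and their simple tops: `B` is finite-dimensional and
standardly stratified, and the standard modules have endomorphism algebra `k`. -/
def IsQuasiHereditary {Λ : Type u'} [PartialOrder Λ] (P : Λ → ModuleCat.{u} B) : Prop :=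
  Module.Finite k B ∧ IsProjectiveLabelling P ∧
    ∃ Δ : Λ → ModuleCat.{u} B, IsStandardFamily P Δ ∧
      ∀ l, Nonempty (CategoryTheory.End (Δ l) ≃ₐ[k] k)

variable {B}

/-- Ext-projective stratifying systems `(Θ, Q)` of finitely generated modules, indexed by a
poset. -/
structure IsEPSS {Λ : Type u'} [PartialOrder Λ] (Θ Q : Λ → ModuleCat.{u} B) : Prop where
  finite_left : ∀ l, Module.Finite B (Θ l)
  nonzero : ∀ l, Nontrivial (Θ l)
  finite_right : ∀ l, Module.Finite B (Q l)
  indecomposable : ∀ l, Indecomposable (Q l)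
  hom_eq_zero : ∀ l m, ¬ l ≤ m → ∀ f : Θ l ⟶ Θ m, f = 0
  exact_sequence : ∀ l, ∃ p : Q l →ₗ[B] Θ l, Function.Surjective p ∧
    IsFiltered Θ {m | l < m} (ModuleCat.of B (LinearMap.ker p))
  ext_eq_zero : ∀ M : ModuleCat.{u} B, IsFiltered Θ Set.univ M →
    ∀ l, Subsingleton (Ext (Q l) M 1)

end Algebras

end

/-! ### Directed systems of idempotents -/

section Directed

open scoped ModuleCat

/-! The Yoneda algebra is directed: its corner `e m * Γ * e l` is `Ext^*(Θ l, Θ m)`, which is zero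
unless `l ≤ m` and is `k` for `l = m`. Since `Q l` has no higher extensions by `Θ m`, `Ext^(s+1)(Θ
l, Θ m)` is a quotient of `Ext^s(K l, Θ m)`, where `K l` is filtered by `Θ n` with `n > l`.
Induction on the degree moves strictly up the poset and gives the vanishing
(`subsingleton_ext_of_not_le`, `subsingleton_ext_self`), finite dimension in each degree
(`finite_ext`) and a bound on the degrees (`subsingleton_ext_of_card_lt`).

A finite-dimensional directed algebra is quasi-hereditary for both orders. Each `B e l` is local,
its radical being the part killed by `e l`, and its other composition factors lie strictly above
`l`. For `≤` the standard modules are the simple tops; for the opposite order they are the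
projectives themselves. -/

/-- A complete family of nonzero orthogonal idempotents `e l` of a `k`-algebra `B`, labelled by a
poset, such that `e m * B * e l` is zero unless `l ≤ m` and `e l * B * e l` is spanned by `e l`. -/
structure IsDirectedFamily (k : Type v) [Field k] {B : Type u} [Ring B] [Algebra k B]
    {Λ : Type u'} [PartialOrder Λ] [Fintype Λ] (e : Λ → B) : Prop where
  mul_self : ∀ l, e l * e l = e l
  mul_eq_zero : ∀ l m, l ≠ m → e l * e m = 0
  sum_eq_one : ∑ l, e l = 1
  ne_zero : ∀ l, e l ≠ 0
  corner_eq_zero : ∀ l m, ¬ l ≤ m → ∀ x, e m * x * e l = 0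
  corner_eq_smul : ∀ l x, ∃ c : k, e l * x * e l = c • e l

/-- The left ideal generated by an element, as a module. -/
abbrev leftIdealModule {B : Type u} [Ring B] (a : B) : ModuleCat.{u} B :=
  ModuleCat.of B (Submodule.span B {a})

/-- Every module of finite length is filtered by any family containing representatives of its
simple subquotients. -/
theorem isFiltered_of_simple {B : Type u} [Ring B] {Λ : Type u'} (F : Λ → ModuleCat.{u} B)
    (s : Set Λ) (M : ModuleCat.{u} B) [IsNoetherian B M] [IsArtinian B M]
    (h : ∀ N₁ N₂ : Submodule B M, N₁ ≤ N₂ → IsSimpleModule B (N₂ ⧸ N₁.submoduleOf N₂) →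
      ∃ l ∈ s, Nonempty ((N₂ ⧸ N₁.submoduleOf N₂) ≃ₗ[B] F l)) :
    IsFiltered F s M := by
  obtain ⟨σ, h0, h1⟩ := exists_compositionSeries_of_isNoetherian_isArtinian B M
  refine ⟨σ.length, σ.toFun, σ.strictMono.monotone, h0, h1, fun i => ?_⟩
  have hc : σ.toFun i.castSucc ⋖ σ.toFun i.succ := σ.step i
  exact h _ _ hc.le ((covBy_iff_quot_is_simple hc.le).1 hc)

/-- If `M` is generated by a nonzero element `v` with `e • v = v`, and `e • M` lies in the line
`k v`, then the endomorphism algebra of `M` is `k`. -/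
theorem nonempty_end_algEquiv {k : Type v} [Field k] {B : Type u} [Ring B] [Algebra k B]
    (M : ModuleCat.{u} B) (e : B) (v : M) (hv : v ≠ 0) (hev : e • v = v)
    (hgen : ∀ x : M, ∃ b : B, x = b • v)
    (hline : ∀ x : M, ∃ c : k, e • x = algebraMap k B c • v) :
    Nonempty (CategoryTheory.End M ≃ₐ[k] k) := by
  have hsmul : ∀ (c : k) (x : M),
      (algebraMap k (CategoryTheory.End M) c).hom x = algebraMap k B c • x := fun c x => rfl
  refine ⟨(AlgEquiv.ofBijective (Algebra.ofId k (CategoryTheory.End M)) ⟨?_, ?_⟩).symm⟩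
  · have : Nontrivial (CategoryTheory.End M) := by
      refine ⟨⟨𝟙 M, 0, fun h => hv ?_⟩⟩
      exact congrArg (fun f : M ⟶ M => f.hom v) h
    exact (algebraMap k (CategoryTheory.End M)).injective
  · intro f
    obtain ⟨c, hc⟩ := hline (ModuleCat.Hom.hom f v)
    refine ⟨c, ?_⟩
    refine ModuleCat.hom_ext (LinearMap.ext fun x => ?_)
    obtain ⟨b, rfl⟩ := hgen x
    refine (hsmul c _).trans ?_
    rw [map_smul]
    -- The image of `v` is fixed by `e`, because `v` is, so it lies on the line `k v`.
    have : ModuleCat.Hom.hom f v = algebraMap k B c • v := by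
      rw [← hc, ← map_smul, hev]
    rw [this, ← mul_smul, ← mul_smul, Algebra.commutes]

/-! ### Modules over a directed algebra. -/

namespace IsDirectedFamily

variable {k : Type v} [Field k] {B : Type u} [Ring B] [Algebra k B]
  {Λ : Type u'} [PartialOrder Λ] [Fintype Λ] {e : Λ → B}

/-- The canonical generator of the left ideal `B e`. -/
abbrev gen (a : B) : leftIdealModule a := ⟨a, Submodule.mem_span_singleton_self a⟩

theorem exists_eq_smul_gen (a : B) (x : leftIdealModule a) : ∃ b : B, x = b • gen a := by
  obtain ⟨b, hb⟩ := Submodule.mem_span_singleton.1 x.2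
  exact ⟨b, Subtype.ext hb.symm⟩

theorem smul_gen (he : IsDirectedFamily k e) (l : Λ) : e l • gen (e l) = gen (e l) :=
  Subtype.ext (he.mul_self l)

theorem gen_ne_zero (he : IsDirectedFamily k e) (l : Λ) : gen (e l) ≠ 0 :=
  fun h => he.ne_zero l (congrArg Subtype.val h)

theorem smul_eq_zero_of_not_le (he : IsDirectedFamily k e) {l m : Λ} (h : ¬ l ≤ m)
    (x : leftIdealModule (e l)) : e m • x = 0 := by
  obtain ⟨b, rfl⟩ := exists_eq_smul_gen _ x
  refine Subtype.ext ?_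
  change e m * (b * e l) = 0
  rw [← mul_assoc, he.corner_eq_zero l m h]

theorem exists_smul_eq (he : IsDirectedFamily k e) (l : Λ) (x : leftIdealModule (e l)) :
    ∃ c : k, e l • x = algebraMap k B c • gen (e l) := by
  obtain ⟨b, rfl⟩ := exists_eq_smul_gen _ x
  obtain ⟨c, hc⟩ := he.corner_eq_smul l b
  refine ⟨c, Subtype.ext ?_⟩
  change e l * (b * e l) = algebraMap k B c * e l
  rw [← mul_assoc, hc, Algebra.smul_def]

theorem eq_sum_smul (he : IsDirectedFamily k e) {M : Type*} [AddCommGroup M] [Module B M]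
    (x : M) : x = ∑ m, e m • x := by
  rw [← Finset.sum_smul, he.sum_eq_one, one_smul]

theorem projective (he : IsDirectedFamily k e) (l : Λ) :
    Module.Projective B (leftIdealModule (e l)) := by
  -- Right multiplication by the idempotent retracts `B` onto the left ideal.
  refine Module.Projective.of_split (M := B) (Submodule.subtype _)
    (LinearMap.toSpanSingleton B _ (gen (e l))) ?_
  ext x
  obtain ⟨b, rfl⟩ := exists_eq_smul_gen _ x
  change (b * e l) * e l = b * e l
  rw [mul_assoc, he.mul_self]

/-- The radical of `B eₗ`: the elements killed by `eₗ`. -/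
def radical (he : IsDirectedFamily k e) (l : Λ) : Submodule B (leftIdealModule (e l)) where
  carrier := {x | e l • x = 0}
  add_mem' {x y} hx hy := by
    simp only [Set.mem_ofPred_eq] at *
    rw [smul_add, hx, hy, add_zero]
  zero_mem' := smul_zero _
  smul_mem' b x hx := by
    simp only [Set.mem_ofPred_eq] at *
    -- In `∑ m, e l * b * e m • x`, a nonzero term needs `m ≤ l` for the corner and `l ≤ m` for `e m
    -- • x`. Only `m = l` is left, and `e l` kills `x`.
    rw [he.eq_sum_smul x, Finset.smul_sum, Finset.smul_sum]
    refine Finset.sum_eq_zero fun m _ => ?_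
    by_cases hlm : l = m
    · subst hlm
      rw [hx, smul_zero, smul_zero]
    · by_cases h1 : l ≤ m
      · rw [← mul_smul, ← mul_smul,
          he.corner_eq_zero m l fun h => hlm (le_antisymm h1 h), zero_smul]
      · rw [he.smul_eq_zero_of_not_le h1, smul_zero, smul_zero]

theorem mem_radical (he : IsDirectedFamily k e) {l : Λ} {x : leftIdealModule (e l)} :
    x ∈ he.radical l ↔ e l • x = 0 := Iff.rfl

theorem gen_notMem_radical (he : IsDirectedFamily k e) (l : Λ) : gen (e l) ∉ he.radical l := by
  rw [he.mem_radical, he.smul_gen]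
  exact he.gen_ne_zero l

/-- An element not killed by `e l` is sent by `e l` to a nonzero multiple of the generator, so it
generates everything. Hence `B e l` is local. -/
theorem le_radical (he : IsDirectedFamily k e) {l : Λ} {N : Submodule B (leftIdealModule (e l))}
    (hN : N ≠ ⊤) : N ≤ he.radical l := by
  intro x hx
  rw [he.mem_radical]
  obtain ⟨c, hc⟩ := he.exists_smul_eq l x
  by_cases h0 : c = 0
  · rw [hc, h0, map_zero, zero_smul]
  · refine absurd ((Submodule.eq_top_iff').2 fun y => ?_) hN
    have hg : gen (e l) ∈ N := by
      have : gen (e l) = (algebraMap k B c⁻¹ * e l) • x := by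
        rw [mul_smul, hc, ← mul_smul, ← map_mul, inv_mul_cancel₀ h0, map_one, one_smul]
      rw [this]
      exact N.smul_mem _ hx
    obtain ⟨b, rfl⟩ := exists_eq_smul_gen _ y
    exact N.smul_mem _ hg

theorem isCoatom_radical (he : IsDirectedFamily k e) (l : Λ) : IsCoatom (he.radical l) :=
  ⟨fun h => he.gen_notMem_radical l (h ▸ Submodule.mem_top),
    fun _ hN => by_contra fun h => hN.not_ge (he.le_radical h)⟩

theorem jacobson_eq (he : IsDirectedFamily k e) (l : Λ) :
    Module.jacobson B (leftIdealModule (e l)) = he.radical l :=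
  le_antisymm (sInf_le (he.isCoatom_radical l)) (le_sInf fun _ hN =>
    ((hN.le_iff.1 (he.le_radical hN.1)).resolve_left (he.isCoatom_radical l).1).le)

/-- The projection of `B a` onto its top. -/
abbrev topMk (a : B) : leftIdealModule a →ₗ[B] moduleTop (leftIdealModule a) :=
  Submodule.mkQ _

theorem topMk_surjective (a : B) : Function.Surjective (topMk a) :=
  Submodule.mkQ_surjective _

theorem topMk_eq_zero_iff (he : IsDirectedFamily k e) {l : Λ} {x : leftIdealModule (e l)} :
    topMk (e l) x = 0 ↔ e l • x = 0 := by
  refine (Submodule.Quotient.mk_eq_zero _).trans ?_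
  rw [he.jacobson_eq, he.mem_radical]

theorem topMk_gen_ne_zero (he : IsDirectedFamily k e) (l : Λ) : topMk (e l) (gen (e l)) ≠ 0 :=
  fun h => he.gen_notMem_radical l (he.topMk_eq_zero_iff.1 h)

theorem smul_topMk_gen (he : IsDirectedFamily k e) (l : Λ) :
    e l • topMk (e l) (gen (e l)) = topMk (e l) (gen (e l)) := by
  rw [← map_smul, he.smul_gen]

/-- The idempotents tell the simple tops apart; this detects both isomorphism types and composition
factors. -/
theorem smul_top_eq_zero_iff (he : IsDirectedFamily k e) {l m : Λ} :
    (∀ x : moduleTop (leftIdealModule (e l)), e m • x = 0) ↔ m ≠ l := by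
  constructor
  · rintro h rfl
    exact he.topMk_gen_ne_zero m ((he.smul_topMk_gen m).symm.trans (h _))
  · intro h x
    obtain ⟨x, rfl⟩ := topMk_surjective _ x
    rw [← map_smul, he.topMk_eq_zero_iff, ← mul_smul, he.mul_eq_zero l m h.symm, zero_smul]

theorem isSimpleModule_top (he : IsDirectedFamily k e) (l : Λ) :
    IsSimpleModule B (moduleTop (leftIdealModule (e l))) := by
  refine isSimpleModule_iff_isCoatom.2 ?_
  rw [he.jacobson_eq]
  exact he.isCoatom_radical l

theorem eq_of_top_equiv (he : IsDirectedFamily k e) {l m : Λ}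
    (f : moduleTop (leftIdealModule (e l)) ≃ₗ[B] moduleTop (leftIdealModule (e m))) : l = m := by
  by_contra h
  refine (he.smul_top_eq_zero_iff (l := l) (m := l)).1 (fun x => f.injective ?_) rfl
  rw [map_smul, map_zero, he.smul_top_eq_zero_iff.2 h]

/-- A simple module not killed by `eₗ` is isomorphic to the top of `B eₗ`. -/
theorem nonempty_equiv_top (he : IsDirectedFamily k e) {S : Type*} [AddCommGroup S] [Module B S]
    [IsSimpleModule B S] {l : Λ} {s : S} (hs : e l • s ≠ 0) :
    Nonempty (S ≃ₗ[B] moduleTop (leftIdealModule (e l))) := by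
  let f : leftIdealModule (e l) →ₗ[B] S :=
    (LinearMap.toSpanSingleton B S s).comp (Submodule.subtype _)
  have hf : f ≠ 0 := fun h => hs (congrArg (fun g : _ →ₗ[B] S => g (gen (e l))) h)
  have hsurj : Function.Surjective f := LinearMap.surjective_of_ne_zero hf
  -- The kernel is a maximal submodule, and the radical is the only one.
  have hker : LinearMap.ker f = Module.jacobson B (leftIdealModule (e l)) := by
    rw [he.jacobson_eq]
    have hc : IsCoatom (LinearMap.ker f) := by
      rw [← isSimpleModule_iff_isCoatom]
      exact IsSimpleModule.congr (f.quotKerEquivOfSurjective hsurj)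
    exact (((hc.le_iff.1 (he.le_radical hc.1)).resolve_left (he.isCoatom_radical l).1)).symm
  exact ⟨((Submodule.quotEquivOfEq _ _ hker.symm).trans
    (f.quotKerEquivOfSurjective hsurj)).symm⟩

theorem exists_smul_ne_zero (he : IsDirectedFamily k e) (S : Type*) [AddCommGroup S] [Module B S]
    [Nontrivial S] : ∃ (l : Λ) (s : S), e l • s ≠ 0 := by
  by_contra! h
  obtain ⟨x, hx⟩ := exists_ne (0 : S)
  refine hx ?_
  rw [he.eq_sum_smul x]
  exact Finset.sum_eq_zero fun l _ => h l x

theorem isProjectiveLabelling (he : IsDirectedFamily k e) :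
    IsProjectiveLabelling fun l => leftIdealModule (e l) where
  finite l := Module.Finite.iff_fg.2 (Submodule.fg_span_singleton _)
  projective := he.projective
  simple_top := he.isSimpleModule_top
  injective _ _ := fun ⟨f⟩ => he.eq_of_top_equiv f
  exhaustive S hS := by
    have := hS
    have : Nontrivial S := IsSimpleModule.nontrivial B S
    obtain ⟨l, s, h⟩ := he.exists_smul_ne_zero S
    exact ⟨l, he.nonempty_equiv_top h⟩

/-- If the top of `B eₘ` is a composition factor of `M`, then `eₘ` does not kill `M`. -/
theorem exists_smul_ne_zero_of_isCompositionFactor (he : IsDirectedFamily k e) {m : Λ}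
    {M : ModuleCat.{u} B} (h : IsCompositionFactor (moduleTop (leftIdealModule (e m))) M) :
    ∃ x : M, e m • x ≠ 0 := by
  obtain ⟨N₁, N₂, -, ⟨f⟩⟩ := h
  by_contra! h
  refine (he.smul_top_eq_zero_iff (l := m) (m := m)).1 (fun x => f.symm.injective ?_) rfl
  rw [map_smul, map_zero]
  obtain ⟨y, hy⟩ := Submodule.Quotient.mk_surjective _ (f.symm x)
  rw [← hy, ← Submodule.Quotient.mk_smul, Submodule.Quotient.mk_eq_zero,
    show e m • y = 0 from Subtype.ext (h y)]
  exact Submodule.zero_mem _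

/-- The projectives serve as standard modules: all kernels are zero, and directedness puts every
composition factor of `B e l` at some `m ≥ l`. -/
theorem isQuasiHereditary_orderDual [Module.Finite k B] (he : IsDirectedFamily k e) :
    IsQuasiHereditary k B fun l : Λᵒᵈ => leftIdealModule (e (OrderDual.ofDual l)) := by
  have hP := he.isProjectiveLabelling
  refine ⟨inferInstance, ⟨fun l => hP.finite _, fun l => hP.projective _,
    fun l => hP.simple_top _, fun l m h => hP.injective _ _ h, hP.exhaustive⟩,
    fun l => leftIdealModule (e (OrderDual.ofDual l)), ⟨fun l m h => ?_, fun l => ?_⟩, fun l => ?_⟩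
  · obtain ⟨x, hx⟩ := he.exists_smul_ne_zero_of_isCompositionFactor h
    by_contra hml
    exact hx (he.smul_eq_zero_of_not_le hml x)
  · refine ⟨LinearMap.id, Function.surjective_id, 0, fun _ => ⊥, monotone_const, rfl, ?_,
      fun i => i.elim0⟩
    have : Subsingleton (LinearMap.ker
      (LinearMap.id : leftIdealModule (e (OrderDual.ofDual l)) →ₗ[B] _)) := by
      rw [LinearMap.ker_id]
      infer_instance
    exact Subsingleton.elim (α := Submodule B (LinearMap.ker _)) _ _
  · exact nonempty_end_algEquiv _ _ _ (he.gen_ne_zero _) (he.smul_gen _)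
      (exists_eq_smul_gen _) (he.exists_smul_eq _)

/-- The simple tops serve as standard modules, so a composition series of the radical is the
required filtration. -/
theorem isQuasiHereditary [Module.Finite k B] (he : IsDirectedFamily k e) :
    IsQuasiHereditary k B fun l : Λ => leftIdealModule (e l) := by
  have hP := he.isProjectiveLabelling
  refine ⟨inferInstance, hP, fun l => moduleTop (leftIdealModule (e l)),
    ⟨fun l m h => ?_, fun l => ?_⟩, fun l => ?_⟩
  · obtain ⟨x, hx⟩ := he.exists_smul_ne_zero_of_isCompositionFactor h
    by_contra hml
    exact hx (he.smul_top_eq_zero_iff.2 (fun h => hml h.le) x)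
  · refine ⟨Submodule.mkQ _, Submodule.mkQ_surjective _, ?_⟩
    have := IsNoetherianRing.of_finite k B
    have := IsArtinianRing.of_finite k B
    have := hP.finite l
    have hfin : Module.Finite B (LinearMap.ker
      (Submodule.mkQ (Module.jacobson B (leftIdealModule (e l))))) := inferInstance
    have : IsNoetherian B (ModuleCat.of B (LinearMap.ker
      (Submodule.mkQ (Module.jacobson B (leftIdealModule (e l)))))) :=
      isNoetherian_of_isNoetherianRing_of_finite B _
    have : IsArtinian B (ModuleCat.of B (LinearMap.ker
      (Submodule.mkQ (Module.jacobson B (leftIdealModule (e l)))))) :=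
      isArtinian_of_fg_of_artinian' 
    refine isFiltered_of_simple _ _ _ fun N₁ N₂ _ hS => ?_
    have := IsSimpleModule.nontrivial B (N₂ ⧸ N₁.submoduleOf N₂)
    obtain ⟨m, s, hs⟩ := he.exists_smul_ne_zero (N₂ ⧸ N₁.submoduleOf N₂)
    refine ⟨m, ?_, he.nonempty_equiv_top hs⟩
    obtain ⟨y, rfl⟩ := Submodule.Quotient.mk_surjective _ s
    have hy : e m • y.1.1 ≠ 0 := by
      intro h
      refine hs ?_
      rw [← Submodule.Quotient.mk_smul, show e m • y = 0 from Subtype.ext (Subtype.ext h)]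
      rfl
    -- Since `e m` does not kill `y`, directedness gives `l ≤ m`; since `e l` kills the radical, `m
    -- ≠ l`.
    have hrad : e l • y.1.1 = 0 := he.topMk_eq_zero_iff.1 (LinearMap.mem_ker.1 y.1.2)
    refine lt_of_le_of_ne (by_contra fun h => hy (he.smul_eq_zero_of_not_le h _)) ?_
    rintro rfl
    exact hy hrad
  · refine nonempty_end_algEquiv _ (e l) _ (he.topMk_gen_ne_zero l) (he.smul_topMk_gen l) ?_ ?_
    · intro x
      obtain ⟨x, rfl⟩ := topMk_surjective _ x
      obtain ⟨b, rfl⟩ := exists_eq_smul_gen _ x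
      exact ⟨b, map_smul _ _ _⟩
    · intro x
      obtain ⟨x, rfl⟩ := topMk_surjective _ x
      obtain ⟨c, hc⟩ := he.exists_smul_eq l x
      exact ⟨c, by rw [← map_smul, hc, map_smul]⟩

end IsDirectedFamily

end Directed

/-! ### Filtered modules and extensions -/

section ExtFiltered

/-- Induction along a filtration: a property of modules that holds for zero modules and the
factors, and is stable under extensions, holds for filtered modules. -/
theorem IsFiltered.induction {B : Type u} [Ring B] {Λ : Type u'} {F : Λ → ModuleCat.{u} B}
    {s : Set Λ} {M : ModuleCat.{u} B} (hM : IsFiltered F s M) (p : ModuleCat.{u} B → Prop)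
    (zero : ∀ N : ModuleCat.{u} B, Subsingleton N → p N)
    (extension : ∀ (N N' : ModuleCat.{u} B) (g : N →ₗ[B] N'), Function.Surjective g →
      p (ModuleCat.of B (LinearMap.ker g)) → p N' → p N)
    (factor : ∀ l ∈ s, p (F l)) : p M := by
  -- Invariance under isomorphism is the case of an extension with zero kernel.
  have iso : ∀ N N' : ModuleCat.{u} B, (N ≃ₗ[B] N') → p N' → p N := fun N N' f h => by
    refine extension N N' f.toLinearMap f.surjective (zero _ ?_) h
    rw [LinearEquiv.ker]
    infer_instance
  obtain ⟨n, N, hmono, h0, hlast, hN⟩ := hM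
  have key : ∀ i, p (ModuleCat.of B (N i)) := by
    intro i
    induction i using Fin.induction with
    | zero =>
      refine zero _ ?_
      rw [h0]
      infer_instance
    | succ i ih =>
      obtain ⟨l, hl, ⟨f⟩⟩ := hN i
      refine extension (ModuleCat.of B (N i.succ)) (F l)
        (f.toLinearMap.comp (Submodule.mkQ _)) (f.surjective.comp (Submodule.mkQ_surjective _))
        (iso _ (ModuleCat.of B (N i.castSucc)) ?_ ih) (factor l hl)
      refine (LinearEquiv.ofEq _ _ ?_).trans
        (Submodule.submoduleOfEquivOfLe (hmono i.castSucc_le_succ))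
      rw [LinearMap.ker_comp, LinearEquiv.ker]
      exact Submodule.ker_mkQ _
  refine iso M (ModuleCat.of B (N (Fin.last n))) ?_ (key _)
  exact (LinearEquiv.ofTop _ hlast).symm

section ShortExact

variable {C : Type u} [Category.{v} C] [Abelian C] [HasExt.{w} C] {S : ShortComplex C}

theorem subsingleton_ext_middle (hS : S.ShortExact) {Y : C} {n : ℕ}
    (h₁ : Subsingleton (Ext S.X₁ Y n)) (h₃ : Subsingleton (Ext S.X₃ Y n)) :
    Subsingleton (Ext S.X₂ Y n) := by
  refine subsingleton_of_forall_eq 0 fun x => ?_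
  obtain ⟨y, rfl⟩ := Ext.contravariant_sequence_exact₂ hS Y x (Subsingleton.elim _ _)
  rw [Subsingleton.elim y 0, Ext.comp_zero]

/-- Dimension shift: when the middle term has no extensions in degree `n + 1`, the connecting map
from `Ext S.X₁ Y n` is onto. -/
theorem subsingleton_ext_succ (hS : S.ShortExact) {Y : C} {n : ℕ}
    (h₁ : Subsingleton (Ext S.X₁ Y n)) (h₂ : Subsingleton (Ext S.X₂ Y (n + 1))) :
    Subsingleton (Ext S.X₃ Y (n + 1)) := by
  refine subsingleton_of_forall_eq 0 fun x => ?_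
  obtain ⟨y, rfl⟩ := Ext.contravariant_sequence_exact₃ hS Y x (Subsingleton.elim _ _)
    (Nat.add_comm 1 n)
  rw [Subsingleton.elim y 0, Ext.comp_zero]

variable (k : Type v') [Field k] [Linear k C]

theorem finite_ext_middle (hS : S.ShortExact) {Y : C} {n : ℕ}
    (h₁ : Module.Finite k (Ext S.X₁ Y n)) (h₃ : Module.Finite k (Ext S.X₃ Y n)) :
    Module.Finite k (Ext S.X₂ Y n) := by
  let f : Ext S.X₃ Y n →ₗ[k] Ext S.X₂ Y n := (Ext.mk₀ S.g).precompOfLinear k Y (zero_add n)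
  let g : Ext S.X₂ Y n →ₗ[k] Ext S.X₁ Y n := (Ext.mk₀ S.f).precompOfLinear k Y (zero_add n)
  -- Exactness bounds the kernel of `g` by `Ext S.X₃ Y n`; its image lies in `Ext S.X₁ Y n`.
  have hfg : LinearMap.ker g ≤ LinearMap.range f := fun x hx =>
    Ext.contravariant_sequence_exact₂ hS Y x hx
  have : Module.Finite k (LinearMap.ker g) := Submodule.finiteDimensional_of_le hfg
  have : Module.Finite k (Ext S.X₂ Y n ⧸ LinearMap.ker g) :=
    Module.Finite.equiv g.quotKerEquivRange.symm
  exact Module.Finite.of_submodule_quotient (LinearMap.ker g)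

theorem finite_ext_succ (hS : S.ShortExact) {Y : C} {n : ℕ}
    (h₁ : Module.Finite k (Ext S.X₁ Y n)) (h₂ : Subsingleton (Ext S.X₂ Y (n + 1))) :
    Module.Finite k (Ext S.X₃ Y (n + 1)) :=
  Module.Finite.of_surjective (hS.extClass.precompOfLinear k Y (Nat.add_comm 1 n)) fun x =>
    Ext.contravariant_sequence_exact₃ hS Y x (Subsingleton.elim _ _) (Nat.add_comm 1 n)

end ShortExact

theorem subsingleton_ext_of_subsingleton {C : Type u} [Category.{v} C] [Abelian C]
    [HasExt.{w} C] {X : C} (hX : IsZero X) (Y : C) (n : ℕ) : Subsingleton (Ext X Y n) := by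
  refine subsingleton_of_forall_eq 0 fun x => ?_
  rw [← Ext.mk₀_id_comp x, hX.eq_of_src (𝟙 X) 0, Ext.mk₀_zero, Ext.zero_comp]

variable {B : Type u} [Ring B] {Λ : Type u'} {F : Λ → ModuleCat.{u} B} {s : Set Λ}
  {M : ModuleCat.{u} B}

theorem IsFiltered.subsingleton_ext (hM : IsFiltered F s M) {Y : ModuleCat.{u} B} {n : ℕ}
    (h : ∀ l ∈ s, Subsingleton (Ext (F l) Y n)) : Subsingleton (Ext M Y n) := by
  refine hM.induction (fun N => Subsingleton (Ext N Y n)) (fun N hN => ?_)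
    (fun N N' g hg h₁ h₃ => ?_) h
  · exact subsingleton_ext_of_subsingleton (ModuleCat.isZero_of_subsingleton N) Y n
  · exact subsingleton_ext_middle (LinearMap.shortExact_shortComplexKer hg) h₁ h₃

theorem IsFiltered.finite_ext (k : Type v) [Field k] [Algebra k B] (hM : IsFiltered F s M)
    {Y : ModuleCat.{u} B} {n : ℕ} (h : ∀ l ∈ s, Module.Finite k (Ext (F l) Y n)) :
    Module.Finite k (Ext M Y n) := by
  refine hM.induction (fun N => Module.Finite k (Ext N Y n)) (fun N hN => ?_)
    (fun N N' g hg h₁ h₃ => ?_) h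
  · have := subsingleton_ext_of_subsingleton (ModuleCat.isZero_of_subsingleton N) Y n
    infer_instance
  · exact finite_ext_middle k (LinearMap.shortExact_shortComplexKer hg) h₁ h₃

open scoped ModuleCat in
theorem finite_hom (k : Type v) [Field k] [Algebra k B] [Module.Finite k B]
    (M N : ModuleCat.{u} B) [Module.Finite B M] [Module.Finite B N] :
    Module.Finite k (M ⟶ N) := by
  have : Module.Finite k M := Module.Finite.trans B M
  have : Module.Finite k N := Module.Finite.trans B N
  let f : (M ⟶ N) →ₗ[k] (M →ₗ[k] N) :=
    { toFun := fun g => g.hom.restrictScalars k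
      map_add' := fun _ _ => rfl
      map_smul' := fun _ _ => rfl }
  exact Module.Finite.of_injective f fun g g' h =>
    ModuleCat.hom_ext (LinearMap.ext fun x => LinearMap.congr_fun h x)

end ExtFiltered

/-! ### Extensions between the modules of a stratifying system. -/

section Stratifying

variable {B : Type u} [Ring B] {Λ : Type u'} [PartialOrder Λ] {Θ Q : Λ → ModuleCat.{u} B}

namespace IsEPSS

theorem subsingleton_ext_succ (h : IsEPSS Θ Q) {l : Λ} {Y : ModuleCat.{u} B} {s : ℕ}
    (hQ : Subsingleton (Ext (Q l) Y (s + 1)))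
    (hΘ : ∀ n, l < n → Subsingleton (Ext (Θ n) Y s)) : Subsingleton (Ext (Θ l) Y (s + 1)) := by
  obtain ⟨p, hp, hK⟩ := h.exact_sequence l
  exact _root_.subsingleton_ext_succ (LinearMap.shortExact_shortComplexKer hp)
    (hK.subsingleton_ext hΘ) hQ

theorem finite_ext (k : Type v) [Field k] [Algebra k B] [Module.Finite k B] (h : IsEPSS Θ Q)
    (hQ : ∀ l m s, Subsingleton (Ext (Q l) (Θ m) (s + 1))) (l m : Λ) (s : ℕ) :
    Module.Finite k (Ext (Θ l) (Θ m) s) := by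
  induction s generalizing l with
  | zero =>
    have := h.finite_left l
    have := h.finite_left m
    have := finite_hom k (Θ l) (Θ m)
    exact Module.Finite.equiv Ext.linearEquiv₀.symm
  | succ s ih =>
    obtain ⟨p, hp, hK⟩ := h.exact_sequence l
    exact finite_ext_succ k (LinearMap.shortExact_shortComplexKer hp)
      (hK.finite_ext k fun n _ => ih n) (hQ l m s)

/-- The hypothesis passes upwards: if `l < n` and `¬ l ≤ m`, then `¬ n ≤ m`. The shift thus descends
to the vanishing of `Hom`. -/
theorem subsingleton_ext_of_not_le (h : IsEPSS Θ Q)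
    (hQ : ∀ l m s, Subsingleton (Ext (Q l) (Θ m) (s + 1))) {l m : Λ} (hlm : ¬ l ≤ m) (s : ℕ) :
    Subsingleton (Ext (Θ l) (Θ m) s) := by
  induction s generalizing l with
  | zero =>
    have : Subsingleton (Θ l ⟶ Θ m) := subsingleton_of_forall_eq 0 (h.hom_eq_zero l m hlm)
    exact Ext.addEquiv₀.toEquiv.subsingleton
  | succ s ih =>
    exact h.subsingleton_ext_succ (hQ l m s) fun n hn => ih fun hnm => hlm (hn.le.trans hnm)

theorem subsingleton_ext_self (h : IsEPSS Θ Q)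
    (hQ : ∀ l m s, Subsingleton (Ext (Q l) (Θ m) (s + 1))) (l : Λ) (s : ℕ) :
    Subsingleton (Ext (Θ l) (Θ l) (s + 1)) :=
  h.subsingleton_ext_succ (hQ l l s) fun _ hn => h.subsingleton_ext_of_not_le hQ hn.not_ge s

/-- Each shift lowers the degree by one and replaces `l` by some `n > l`, with strictly fewer
elements above it. -/
theorem subsingleton_ext_of_card_lt [Finite Λ] (h : IsEPSS Θ Q)
    (hQ : ∀ l m s, Subsingleton (Ext (Q l) (Θ m) (s + 1))) (l m : Λ) (s : ℕ)
    (hs : (Set.Ioi l).ncard < s) : Subsingleton (Ext (Θ l) (Θ m) s) := by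
  induction s generalizing l with
  | zero => exact absurd hs (Nat.not_lt_zero _)
  | succ s ih =>
    refine h.subsingleton_ext_succ (hQ l m s) fun n hn => ih n ?_
    refine lt_of_lt_of_le ?_ (Nat.le_of_lt_succ hs)
    exact Set.ncard_lt_ncard (Set.Ioi_ssubset_Ioi hn) (Set.toFinite _)

end IsEPSS

end Stratifying

/-! ### The Yoneda algebra of a directed family of objects -/

section DirectedYoneda

variable {C : Type u} [Category.{v} C] [Abelian C] [HasExt.{w} C]

namespace ExtAlgebra

theorem of_mul_of (X : C) {i j : ℕ} (x : Ext X X i) (y : Ext X X j) :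
    of X i x * of X j y = of X (i + j) (y.comp x (Nat.add_comm j i)) :=
  DirectSum.of_mul_of (A := fun i => Ext X X i) x y

theorem of_mk₀_mul_of_mul_of_mk₀ (X : C) (f g : X ⟶ X) {i : ℕ} (y : Ext X X i) :
    of X 0 (Ext.mk₀ g) * of X i y * of X 0 (Ext.mk₀ f) =
      of X i ((Ext.mk₀ f).comp (y.comp (Ext.mk₀ g) (add_zero i)) (zero_add i)) := by
  -- The product lives in degree `0 + i + 0`; leaving the degrees as variables allows them to be
  -- substituted by `i`.
  have key : ∀ (j j' : ℕ) (hj : i + 0 = j) (hj' : 0 + j = j'),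
      of X j' ((Ext.mk₀ f).comp (y.comp (Ext.mk₀ g) hj) hj') =
        of X i ((Ext.mk₀ f).comp (y.comp (Ext.mk₀ g) (add_zero i)) (zero_add i)) := by
    intro j j' hj hj'
    obtain rfl : i = j := by omega
    obtain rfl : i = j' := by omega
    rfl
  rw [of_mul_of, of_mul_of]
  exact key _ _ _ _

theorem of_injective (X : C) (i : ℕ) : Function.Injective (of X i) :=
  DirectSum.of_injective (β := fun i => Ext X X i) i

@[elab_as_elim]
theorem induction {X : C} {p : ExtAlgebra X → Prop} (x : ExtAlgebra X) (zero : p 0)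
    (of : ∀ i y, p (of X i y)) (add : ∀ x y, p x → p y → p (x + y)) : p x :=
  DirectSum.induction_on x zero of add

variable {Λ : Type u'} [Finite Λ] (X : Λ → C)

/-- The component in `Ext^i(Xₗ, Xₘ)` of an element of `Ext^i(⨁ X, ⨁ X)`. -/
noncomputable def entry {i : ℕ} (y : Ext (⨁ X) (⨁ X) i) (l m : Λ) : Ext (X l) (X m) i :=
  (Ext.mk₀ (biproduct.ι X l)).comp (y.comp (Ext.mk₀ (biproduct.π X m)) (add_zero i)) (zero_add i)

theorem comp_entry_comp {i : ℕ} (y : Ext (⨁ X) (⨁ X) i) (l m : Λ) :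
    (Ext.mk₀ (biproduct.π X l ≫ biproduct.ι X l)).comp
        (y.comp (Ext.mk₀ (biproduct.π X m ≫ biproduct.ι X m)) (add_zero i)) (zero_add i) =
      (Ext.mk₀ (biproduct.π X l)).comp
        ((entry X y l m).comp (Ext.mk₀ (biproduct.ι X m)) (add_zero i)) (zero_add i) := by
  simp only [entry, ← Ext.mk₀_comp_mk₀, Ext.comp_assoc_of_third_deg_zero,
    Ext.comp_assoc_of_second_deg_zero]

/-- Products compose from right to left, so the source idempotent stands on the right and the corner
depends only on the matrix entry from `X l` to `X m`. -/
theorem idem_mul_of_mul_idem {i : ℕ} (y : Ext (⨁ X) (⨁ X) i) (l m : Λ) :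
    idem X m * of (⨁ X) i y * idem X l =
      of (⨁ X) i ((Ext.mk₀ (biproduct.π X l)).comp
        ((entry X y l m).comp (Ext.mk₀ (biproduct.ι X m)) (add_zero i)) (zero_add i)) := by
  rw [idem, idem, of_mk₀_mul_of_mul_of_mk₀, comp_entry_comp]

theorem idem_mul_of_mul_idem_eq_zero {i : ℕ} (y : Ext (⨁ X) (⨁ X) i) {l m : Λ}
    (h : Subsingleton (Ext (X l) (X m) i)) : idem X m * of (⨁ X) i y * idem X l = 0 := by
  rw [idem_mul_of_mul_idem, Subsingleton.elim (entry X y l m) 0, Ext.zero_comp, Ext.comp_zero,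
    map_zero]

theorem idem_mul_idem (l m : Λ) : idem X l * idem X m =
    of (⨁ X) 0 (Ext.mk₀ ((biproduct.π X m ≫ biproduct.ι X m) ≫
      (biproduct.π X l ≫ biproduct.ι X l))) := by
  rw [idem, idem, of_mul_of, Ext.mk₀_comp_mk₀]

theorem sum_idem [Fintype Λ] : ∑ l, idem X l = 1 := by
  simp only [idem]
  rw [← map_sum, ← Ext.mk₀_sum]
  exact congrArg (fun f => of (⨁ X) 0 (Ext.mk₀ f))
    (IsBilimit.total (biproduct.isBilimit X))

theorem idem_ne_zero {l : Λ} (h : ¬ IsZero (X l)) : idem X l ≠ 0 := by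
  intro h0
  refine h ((IsZero.iff_id_eq_zero _).2 ?_)
  have h1 : biproduct.π X l ≫ biproduct.ι X l = 0 := by
    refine (Ext.mk₀_bijective _ _).1 (of_injective _ _ (h0.trans ?_))
    rw [Ext.mk₀_zero, map_zero]
  calc 𝟙 (X l) = biproduct.ι X l ≫ (biproduct.π X l ≫ biproduct.ι X l) ≫ biproduct.π X l := by
        simp
    _ = 0 := by rw [h1, zero_comp, comp_zero]

variable (k : Type v') [Field k] [Linear k C]

theorem of_smul (Y : C) (i : ℕ) (c : k) (y : Ext Y Y i) : of Y i (c • y) = c • of Y i y :=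
  (DirectSum.lof k ℕ (fun i => Ext Y Y i) i).map_smul c y

variable {X k}

theorem isDirectedFamily [PartialOrder Λ] [Fintype Λ] (hX : ∀ l, ¬ IsZero (X l))
    (hle : ∀ l m s, ¬ l ≤ m → Subsingleton (Ext (X l) (X m) s))
    (hself : ∀ l s, Subsingleton (Ext (X l) (X l) (s + 1)))
    (hend : ∀ l (f : X l ⟶ X l), ∃ c : k, f = c • 𝟙 (X l)) :
    IsDirectedFamily k (idem X) where
  mul_self l := by
    rw [idem_mul_idem, idem]
    simp
  mul_eq_zero l m hlm := by
    rw [idem_mul_idem, Category.assoc, biproduct.ι_π_ne_assoc X hlm.symm, zero_comp, comp_zero,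
      Ext.mk₀_zero, map_zero]
  sum_eq_one := sum_idem X
  ne_zero l := idem_ne_zero X (hX l)
  corner_eq_zero l m hlm x := by
    induction x using ExtAlgebra.induction with
    | zero => rw [mul_zero, zero_mul]
    | of i y => exact idem_mul_of_mul_idem_eq_zero X y (hle l m i hlm)
    | add x y hx hy => rw [mul_add, add_mul, hx, hy, add_zero]
  corner_eq_smul l x := by
    induction x using ExtAlgebra.induction with
    | zero => exact ⟨0, by rw [mul_zero, zero_mul, zero_smul]⟩
    | add x y hx hy =>
      obtain ⟨c, hc⟩ := hx
      obtain ⟨d, hd⟩ := hy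
      exact ⟨c + d, by rw [mul_add, add_mul, hc, hd, add_smul]⟩
    | of i y =>
      cases i with
      | succ i =>
        exact ⟨0, by rw [idem_mul_of_mul_idem_eq_zero X y (hself l i), zero_smul]⟩
      | zero =>
        -- Only degree zero contributes to a diagonal corner, and there the entry is an endomorphism
        -- of `X l`, hence a scalar.
        obtain ⟨f, hf⟩ := (Ext.mk₀_bijective _ _).2 (entry X y l l)
        obtain ⟨c, hc⟩ := hend l f
        refine ⟨c, ?_⟩
        rw [idem_mul_of_mul_idem, ← hf, hc, Ext.mk₀_comp_mk₀, Ext.mk₀_comp_mk₀, idem, ← of_smul,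
          ← Ext.mk₀_smul, Linear.smul_comp, Linear.comp_smul, Category.id_comp]

theorem finite (hfin : ∀ l m s, Module.Finite k (Ext (X l) (X m) s)) (N : ℕ)
    (hN : ∀ l m s, N ≤ s → Subsingleton (Ext (X l) (X m) s)) :
    Module.Finite k (ExtAlgebra (⨁ X)) := by
  have := Fintype.ofFinite Λ
  let ent (i : ℕ) : Ext (⨁ X) (⨁ X) i →ₗ[k] (∀ l m, Ext (X l) (X m) i) :=
    LinearMap.pi fun l => LinearMap.pi fun m =>
      ((Ext.mk₀ (biproduct.ι X l)).precompOfLinear k (X m) (zero_add i)).comp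
        ((Ext.mk₀ (biproduct.π X m)).postcompOfLinear k (⨁ X) (add_zero i))
  have hent : ∀ i, Function.Injective (ent i) := by
    intro i
    refine (injective_iff_map_eq_zero _).2 fun y hy => of_injective _ i ?_
    -- Writing `1` as the sum of the idempotents on both sides recovers `y` from its matrix entries.
    rw [map_zero, ← mul_one (of (⨁ X) i y), ← one_mul (of (⨁ X) i y), ← sum_idem X,
      Finset.sum_mul, Finset.sum_mul_sum]
    refine Finset.sum_eq_zero fun m _ => Finset.sum_eq_zero fun l _ => ?_
    rw [idem_mul_of_mul_idem, show entry X y l m = 0 from congrFun (congrFun hy l) m,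
      Ext.zero_comp, Ext.comp_zero, map_zero]
  have (i : ℕ) : Module.Finite k (Ext (⨁ X) (⨁ X) i) := Module.Finite.of_injective _ (hent i)
  have hsub (i : ℕ) (hi : N ≤ i) : Subsingleton (Ext (⨁ X) (⨁ X) i) := by
    have := fun l m => hN l m i hi
    exact (hent i).subsingleton
  -- Truncation to degrees below `N` is injective because the other components are zero.
  let f : DirectSum ℕ (fun i => Ext (⨁ X) (⨁ X) i) →ₗ[k] (∀ i : Fin N, Ext (⨁ X) (⨁ X) i) :=
    LinearMap.pi fun i => DirectSum.component k ℕ _ i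
  refine Module.Finite.of_injective (M := ExtAlgebra (⨁ X)) f ?_
  refine (injective_iff_map_eq_zero _).2 fun x hx => DFinsupp.ext fun i => ?_
  by_cases hi : i < N
  · exact congrFun hx ⟨i, hi⟩
  · have := hsub i (not_lt.1 hi)
    exact Subsingleton.elim _ _

end ExtAlgebra

end DirectedYoneda

/-! ### Translation of the hypotheses and conclusion. -/

theorem subsingleton_ext_of_biproduct {C : Type u} [Category.{v} C] [Abelian C] [HasExt.{w} C]
    {Λ : Type u'} [Finite Λ] (X Y : Λ → C) {s : ℕ} (h : Subsingleton (Ext (⨁ X) (⨁ Y) s))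
    (l m : Λ) : Subsingleton (Ext (X l) (Y m) s) := by
  refine subsingleton_of_forall_eq 0 fun x => ?_
  have hx : (Ext.mk₀ (biproduct.π X l)).comp (x.comp (Ext.mk₀ (biproduct.ι Y m)) (add_zero s))
      (zero_add s) = 0 := Subsingleton.elim _ _
  -- Restricting to the summands undoes the passage to the biproducts, so `x` itself is zero.
  have hx' := congrArg (fun y => (Ext.mk₀ (biproduct.ι X l)).comp
    (y.comp (Ext.mk₀ (biproduct.π Y m)) (add_zero s)) (zero_add s)) hx
  simpa using hx'

theorem exists_eq_smul_id_of_end_algEquiv {k : Type v'} [Field k] {C : Type u} [Category.{v} C]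
    [Preadditive C] [Linear k C] {X : C} (φ : CategoryTheory.End X ≃ₐ[k] k) (f : X ⟶ X) :
    ∃ c : k, f = c • 𝟙 X := by
  refine ⟨φ f, φ.injective ?_⟩
  refine Eq.trans ?_ (φ.toLinearMap.map_smul (φ f) (1 : CategoryTheory.End X)).symm
  change φ f = φ f • φ 1
  rw [map_one, smul_eq_mul, mul_one]

theorem corollary1p12 {k : Type v} [Field k] [IsAlgClosed k]
    {A : Type u} [Ring A] [Algebra k A] [Module.Finite k A]
    {Λ : Type u'} [PartialOrder Λ] [Finite Λ]
    (Θ Q : Λ → ModuleCat.{u} A) (hΘQ : IsEPSS Θ Q)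
    (hExt : ∀ s : ℕ, 1 ≤ s → Subsingleton (Ext (⨁ Q) (⨁ Θ) s))
    (hEnd : ∀ l : Λ, Nonempty (CategoryTheory.End (Θ l) ≃ₐ[k] k)) :
    IsQuasiHereditary k (ExtAlgebra (⨁ Θ)) (ExtAlgebra.proj Θ) ∧
      IsQuasiHereditary k (ExtAlgebra (⨁ Θ))
        (fun l : Λᵒᵈ => ExtAlgebra.proj Θ (OrderDual.ofDual l)) := by

  have := Fintype.ofFinite Λ
  have hQ : ∀ l m s, Subsingleton (Ext (Q l) (Θ m) (s + 1)) := fun l m s =>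
    subsingleton_ext_of_biproduct Q Θ (hExt (s + 1) (Nat.le_add_left 1 s)) l m
  have hdir : IsDirectedFamily k (ExtAlgebra.idem Θ) := ExtAlgebra.isDirectedFamily
    (fun l hl => not_subsingleton_iff_nontrivial.2 (hΘQ.nonzero l)
      (ModuleCat.subsingleton_of_isZero hl))
    (fun l m s hlm => hΘQ.subsingleton_ext_of_not_le hQ hlm s)
    (hΘQ.subsingleton_ext_self hQ)
    (fun l f => exists_eq_smul_id_of_end_algEquiv (hEnd l).some f)
  have hfin : Module.Finite k (ExtAlgebra (⨁ Θ)) :=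
    -- At most `Nat.card Λ` elements lie above `l`; the extra one gives the strict inequality.
    ExtAlgebra.finite (hΘQ.finite_ext k hQ) (Nat.card Λ + 1) fun l m s hs =>
      hΘQ.subsingleton_ext_of_card_lt hQ l m s ((Set.ncard_le_card _).trans_lt hs)
  exact ⟨hdir.isQuasiHereditary, hdir.isQuasiHereditary_orderDual⟩
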